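/- All graphs are finite, simple and connected. A set $D\subseteq V(G)$ is a distance-$2$ dominating set (D2DS) of $G$ if every vertex of $G$ is at distance at most $2$ from some vertex of $D$. A split graph is a graph whose vertex set is partitioned into a clique $K$ and an independent set $S$. A $\mathsf{TJ}$-sequence of length $q$ between D2DSs $D_s$ and $D_t$ of $G$ is a sequence $D_s=D_0,D_1,\dots,D_q=D_t$ of D2DSs of $G$ such that for each $0\le i<q$ there are vertices $x_i,y_i$ with $D_i\setminus D_{i+1}=\{x_i\}$ and $D_{i+1}\setminus D_i=\{y_i\}$; it is a $\mathsf{TS}$-sequence if moreover $x_iy_i\in E(G)$ for every $i$. For $\mathsf R\in\{\mathsf{TS},\mathsf{TJ}\}$ let $\mathrm{opt}_{\mathsf R}(G,D_s,D_t)$ be the length of a shortest $\mathsf R$-sequence between $D_s$ and $D_t$ ($\infty$ if there is none). For $|D_s|=|D_t|$ put $$M^\star_{\mathsf{TS}}(G,D_s,D_t)=\min_f\sum_{u\in D_s}\mathrm{dist}_G(u,f(u)),\qquad M^\star_{\mathsf{TJ}}(G,D_s,D_t)=\frac{|D_s\,\Delta\,D_t|}{2},$$ where $f$ ranges over all bijections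 $D_s\to D_t$. **Theorem.** For every split graph $G$ and all D2DSs $D_s,D_t$ of $G$ with $|D_s|=|D_t|$: (a) $M^\star_{\mathsf{TS}}(G,D_s,D_t)\le \mathrm{opt}_{\mathsf{TS}}(G,D_s,D_t)\le M^\star_{\mathsf{TS}}(G,D_s,D_t)+2$; (b) $M^\star_{\mathsf{TJ}}(G,D_s,D_t)\le \mathrm{opt}_{\mathsf{TJ}}(G,D_s,D_t)\le M^\star_{\mathsf{TJ}}(G,D_s,D_t)+1$. Additionally, for every $k\ge 2$ there is such an instance $(G,D_s,D_t)$ with $|D_s|=|D_t|=k$ and $\mathrm{opt}_{\mathsf{TS}}(G,D_s,D_t)=M^\star_{\mathsf{TS}}(G,D_s,D_t)+2$, and there is such an instance with $|D_s|=|D_t|=k$ and $\mathrm{opt}_{\mathsf{TJ}}(G,D_s,D_t)=M^\star_{\mathsf{TJ}}(G,D_s,D_t)+1$. -/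

import Mathlib

namespace DomReconf

/-- `D` is a distance-`r` dominating set of `G`: every vertex is within distance `r`
of some member of `D`. -/
def IsDistDominating {V : Type*} (G : SimpleGraph V) (r : ℕ) (D : Finset V) : Prop :=
  ∀ u : V, ∃ v ∈ D, G.edist u v ≤ (r : ℕ∞)

/-- `V(G) = K ⊎ S` with `K` a clique and `S` an independent set. -/
structure IsSplitPartition {V : Type*} (G : SimpleGraph V) (K S : Set V) : Prop where
  isCompl : IsCompl K S
  isClique : G.IsClique K
  isIndepSet : G.IsIndepSet S

/-- The two reconfiguration rules: token sliding and token jumping. -/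
inductive Rule
  | TS
  | TJ

/-- A move from `x` to `y` respects the rule: for token sliding, `xy` must be an edge;
for token jumping there is no restriction. -/
def Rule.Allows {V : Type*} (R : Rule) (G : SimpleGraph V) (x y : V) : Prop :=
  match R with
  | .TS => G.Adj x y
  | .TJ => True

/-- The token-set `D'` is obtained from `D` by applying the rule `R` exactly once. -/
def Step {V : Type*} [DecidableEq V] (R : Rule) (G : SimpleGraph V) (D D' : Finset V) : Prop :=
  ∃ x y : V, D \ D' = {x} ∧ D' \ D = {y} ∧ R.Allows G x y

/-- `D 0, D 1, …, D q` is an `R`-sequence of distance-`r` dominating sets of `G` between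
`Ds` and `Dt`; its length is `q`. -/
structure IsReconfSeq {V : Type*} [DecidableEq V] (R : Rule) (G : SimpleGraph V) (r : ℕ)
    (Ds Dt : Finset V) (q : ℕ) (D : ℕ → Finset V) : Prop where
  first : D 0 = Ds
  last : D q = Dt
  dominating : ∀ i ≤ q, IsDistDominating G r (D i)
  step : ∀ i < q, Step R G (D i) (D (i + 1))

/-- The length of a shortest `R`-sequence of distance-`r` dominating sets between `Ds` and `Dt`;
it is `⊤` if there is no such sequence. -/
noncomputable def opt {V : Type*} [DecidableEq V] (R : Rule) (G : SimpleGraph V) (r : ℕ)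
    (Ds Dt : Finset V) : ℕ∞ :=
  ⨅ q ∈ {q : ℕ | ∃ D : ℕ → Finset V, IsReconfSeq R G r Ds Dt q D}, (q : ℕ∞)

/-- The minimum, over all bijections `f` from `Ds` to `Dt`, of the sum of the distances
between `u` and `f u`; it is `⊤` if there is no bijection. -/
noncomputable def minTS {V : Type*} (G : SimpleGraph V) (Ds Dt : Finset V) : ℕ∞ :=
  ⨅ f : Ds ≃ Dt, ∑ u : Ds, G.edist (u : V) (f u : V)

/-- Half of the size of the symmetric difference of `Ds` and `Dt`. For sets of equal size the
division is exact, see `two_mul_minTJ`. -/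
def minTJ {V : Type*} [DecidableEq V] (Ds Dt : Finset V) : ℕ :=
  (symmDiff Ds Dt).card / 2

theorem two_mul_minTJ {V : Type*} [DecidableEq V] {Ds Dt : Finset V} (h : Ds.card = Dt.card) :
    2 * minTJ Ds Dt = (symmDiff Ds Dt).card := by
  have h1 : (symmDiff Ds Dt).card = (Ds \ Dt).card + (Dt \ Ds).card := by
    rw [symmDiff_def, Finset.sup_eq_union, Finset.card_union_of_disjoint disjoint_sdiff_sdiff]
  have h2 := Finset.card_sdiff_add_card_inter Ds Dt
  have h3 := Finset.card_sdiff_add_card_inter Dt Ds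
  rw [Finset.inter_comm] at h3
  unfold minTJ
  omega

/-- `(G, Ds, Dt)` is an instance of distance-`r` dominating set reconfiguration on split graphs:
`G` is a connected split graph, with split partition `K ⊎ S`, and `Ds`, `Dt` are distance-`r`
dominating sets of `G` of the same size. -/
structure IsSplitInstance {V : Type*} (G : SimpleGraph V) (K S : Set V) (r : ℕ)
    (Ds Dt : Finset V) : Prop where
  connected : G.Connected
  split : IsSplitPartition G K S
  source : IsDistDominating G r Ds
  target : IsDistDominating G r Dt
  card_eq : Ds.card = Dt.card

end DomReconf

namespace DomReconf

open Finset Equiv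

/-! In a connected split graph every vertex is within distance 2 of every clique vertex, so a token
set meeting `K` dominates automatically. Domination can only fail while no token is on `K`, and the
upper bounds rest on keeping a token there.

Lower bounds: a slide raises the cost of a matching by at most 1 (`cost_swap_mul_le`), and a step of
either kind removes at most one token from `D \ D'` (`card_sdiff_le`).

Jumping: a clique token waits while all other exchanges are made and jumps last, which wastes
nothing. If `D` misses `K`, one preliminary jump into `K` is the extra move.

Sliding: matchings are permutations `σ` of `V` with `σ(D) = D'`, so that exchanging targets is
composition with a transposition. If `D ≠ D'`, some slide lowers the cost (`exists_step_cost`). Such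
slides are made as long as a token remains on `K`. When none is available, a single token occupies
`K`, at `p`, every other moving token has to travel `u, p, σ u`, and `p` can only go to a neighbour
outside `K`. The blocker then steps aside to another clique vertex `q`, the others pass through `p`,
and it returns: the detour `p, q, p` is the extra 2 (`opt_TS_le_of_blocked`).

Sharpness: a grid-like incidence makes every direct first jump lose domination; in a double star,
parity and domination force the detour. -/

theorem exists_adj_dist_add_one {V : Type*} {G : SimpleGraph V} (hG : G.Connected) {x t : V}
    (h : x ≠ t) :
    ∃ y, G.Adj x y ∧ G.dist y t + 1 = G.dist x t := by
  obtain ⟨w, hw⟩ := hG.exists_walk_length_eq_dist x t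
  cases w with
  | nil => exact absurd rfl h
  | @cons _ y _ hxy w =>
    refine ⟨y, hxy, le_antisymm ?_ ?_⟩
    · rw [← hw, SimpleGraph.Walk.length_cons]
      exact Nat.succ_le_succ (SimpleGraph.dist_le w)
    · have := hG.dist_triangle (u := x) (v := y) (w := t)
      rw [SimpleGraph.dist_eq_one_iff_adj.2 hxy] at this
      omega

/-! ### Concatenation and single steps of reconfiguration sequences. -/

section Sequences

variable {V : Type*} [DecidableEq V] {R : Rule} {G : SimpleGraph V} {r : ℕ}
  {D D' D'' : Finset V} {q q' : ℕ}

theorem IsReconfSeq.opt_le {s : ℕ → Finset V} (h : IsReconfSeq R G r D D' q s) :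
    opt R G r D D' ≤ q :=
  iInf₂_le q ⟨s, h⟩

theorem le_opt {m : ℕ∞} (h : ∀ q s, IsReconfSeq R G r D D' q s → m ≤ q) :
    m ≤ opt R G r D D' :=
  le_iInf₂ fun q ⟨s, hs⟩ => h q s hs

theorem exists_isReconfSeq_of_opt_ne_top (h : opt R G r D D' ≠ ⊤) :
    ∃ q s, IsReconfSeq R G r D D' q s ∧ opt R G r D D' = q := by
  have hne : {q : ℕ | ∃ s, IsReconfSeq R G r D D' q s}.Nonempty := by
    by_contra hempty
    rw [Set.not_nonempty_iff_eq_empty] at hempty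
    exact h (by simp [opt, hempty])
  obtain ⟨s, hs⟩ := Nat.sInf_mem hne
  refine ⟨_, s, hs, le_antisymm hs.opt_le (le_opt fun q s' hs' => ?_)⟩
  exact_mod_cast Nat.sInf_le (s := {q | ∃ s, IsReconfSeq R G r D D' q s}) ⟨s', hs'⟩

theorem opt_self (h : IsDistDominating G r D) : opt R G r D D = 0 := by
  have : IsReconfSeq R G r D D 0 fun _ => D := ⟨rfl, rfl, fun _ _ => h, by simp⟩
  simpa using this.opt_le

theorem opt_le_one (hD : IsDistDominating G r D) (hD' : IsDistDominating G r D')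
    (h : Step R G D D') : opt R G r D D' ≤ 1 := by
  have : IsReconfSeq R G r D D' 1 fun i => if i = 0 then D else D' :=
    ⟨rfl, rfl, fun i _ => by split_ifs <;> assumption, fun i hi => by
      obtain rfl : i = 0 := by omega
      simpa using h⟩
  simpa using this.opt_le

theorem IsReconfSeq.append {s s' : ℕ → Finset V} (h : IsReconfSeq R G r D D' q s)
    (h' : IsReconfSeq R G r D' D'' q' s') :
    IsReconfSeq R G r D D'' (q + q') fun i => if i ≤ q then s i else s' (i - q) where
  first := by simp [h.first]
  last := by
    rcases Nat.eq_zero_or_pos q' with rfl | hq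
    · simp [h.last, ← h'.first, h'.last]
    · simp [hq.ne', h'.last]
  dominating i hi := by
    split_ifs with hq
    · exact h.dominating i hq
    · exact h'.dominating _ (by omega)
  step i hi := by
    rcases lt_trichotomy i q with hq | rfl | hq
    · simpa [hq.le, Nat.succ_le_of_lt hq] using h.step i hq
    · simpa [h.last, ← h'.first] using h'.step 0 (by omega)
    · have e : i + 1 - q = i - q + 1 := by omega
      simpa [hq.not_ge, show ¬ i + 1 ≤ q by omega, e] using h'.step (i - q) (by omega)

theorem opt_triangle : opt R G r D D'' ≤ opt R G r D D' + opt R G r D' D'' := by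
  by_cases h : opt R G r D D' = ⊤
  · simp [h]
  by_cases h' : opt R G r D' D'' = ⊤
  · simp [h']
  obtain ⟨q, s, hs, e⟩ := exists_isReconfSeq_of_opt_ne_top h
  obtain ⟨q', s', hs', e'⟩ := exists_isReconfSeq_of_opt_ne_top h'
  rw [e, e']
  exact_mod_cast (hs.append hs').opt_le

theorem Step.insert_erase {x y : V} (hx : x ∈ D) (hy : y ∉ D) (h : R.Allows G x y) :
    Step R G D (insert y (D.erase x)) := by
  have hxy : x ≠ y := fun e => hy (e ▸ hx)
  refine ⟨x, y, ?_, ?_, h⟩ <;> ext z <;> simp only [mem_sdiff, mem_insert, mem_erase,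
    mem_singleton] <;> grind

theorem Step.exists_eq_insert_erase (h : Step R G D D') :
    ∃ x ∈ D, ∃ y ∉ D, R.Allows G x y ∧ D' = insert y (D.erase x) := by
  obtain ⟨x, y, hx, hy, h⟩ := h
  simp only [Finset.ext_iff, mem_sdiff, mem_singleton] at hx hy
  refine ⟨x, by grind, y, by grind, h, ?_⟩
  ext z
  simp only [mem_insert, mem_erase]
  grind

theorem insert_erase_sdiff {u v : V} (hv : v ∈ D') :
    insert v (D.erase u) \ D' = (D \ D').erase u := by
  rw [insert_sdiff_of_mem _ hv, erase_sdiff_comm]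

theorem image_swap_eq_insert_erase {x y : V} (hx : x ∈ D) (hy : y ∉ D) :
    D.image (swap x y) = insert y (D.erase x) := by
  ext z
  simp only [mem_image, mem_insert, mem_erase]
  constructor
  · rintro ⟨a, ha, rfl⟩
    rw [swap_apply_def]
    grind
  · intro h
    refine ⟨swap x y z, ?_, swap_apply_self _ _ _⟩
    rw [swap_apply_def]
    grind

end Sequences

/-! ### Matchings of tokens with targets, and cost-decreasing slides. -/

section Matchings

variable {V : Type*} [DecidableEq V] {G : SimpleGraph V} {D D' : Finset V} {σ : Perm V}

/-- The total distance travelled when every token `u ∈ D` is sent to `σ u`. -/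
noncomputable def cost (G : SimpleGraph V) (σ : Perm V) (D : Finset V) : ℕ :=
  ∑ u ∈ D, G.dist u (σ u)

theorem minTS_le_cost (hG : G.Connected) (h : D.image σ = D') : minTS G D D' ≤ cost G σ D := by
  have hm : ∀ u, u ∈ D ↔ σ u ∈ D' := fun u => by simp [← h]
  refine (iInf_le (fun f : D ≃ D' => ∑ u : D, G.edist (u : V) (f u : V))
    (σ.subtypeEquiv hm)).trans ?_
  rw [cost, ← sum_coe_sort D, Nat.cast_sum]
  refine le_of_eq (sum_congr rfl fun u _ => ?_)
  rw [(hG u (σ u)).coe_dist_eq_edist]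
  rfl

/-- Finiteness of `V` lets an optimal bijection `D ≃ D'` extend to a permutation of all of `V`; the
values off `D` do not affect the cost. -/
theorem exists_cost_eq_minTS [Finite V] (hG : G.Connected) (h : D.card = D'.card) :
    ∃ σ : Perm V, D.image σ = D' ∧ (cost G σ D : ℕ∞) = minTS G D D' := by
  have : Nonempty (D ≃ D') := ⟨Finset.equivOfCardEq h⟩
  obtain ⟨f, hf⟩ := ENat.exists_eq_iInf
    fun f : D ≃ D' => ∑ u : D, G.edist (u : V) (f u : V)
  have : Fintype V := Fintype.ofFinite V
  have he : ∀ u : D, f.extendSubtype u = f u := fun u => f.extendSubtype_apply_of_mem u u.2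
  refine ⟨f.extendSubtype, ?_, ?_⟩
  · ext v
    simp only [mem_image]
    constructor
    · rintro ⟨u, hu, rfl⟩
      rw [he ⟨u, hu⟩]
      exact (f ⟨u, hu⟩).2
    · intro hv
      refine ⟨f.symm ⟨v, hv⟩, (f.symm ⟨v, hv⟩).2, ?_⟩
      rw [he]
      simp
  · rw [minTS, ← hf, cost, ← sum_coe_sort, Nat.cast_sum]
    refine sum_congr rfl fun u _ => ?_
    rw [(hG u _).coe_dist_eq_edist, he]

/-- Sliding a token increases the cost of a matching into the current token set by at most one. -/
theorem cost_swap_mul_le (hG : G.Connected) {x y : V} (hxy : G.Adj x y) (hx : x ∈ D.image σ)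
    (hy : y ∉ D.image σ) : cost G (swap x y * σ) D ≤ cost G σ D + 1 := by
  obtain ⟨a, ha, rfl⟩ := mem_image.1 hx
  rw [cost, cost, ← add_sum_erase _ _ ha, ← add_sum_erase _ _ ha]
  have h1 : ∀ u ∈ D.erase a, G.dist u ((swap (σ a) y * σ) u) = G.dist u (σ u) := by
    intro u hu
    rw [Perm.mul_apply, swap_apply_of_ne_of_ne]
    · exact fun e => (mem_erase.1 hu).1 (σ.injective e)
    · rintro rfl
      exact hy (mem_image_of_mem _ (mem_erase.1 hu).2)
  rw [sum_congr rfl h1, Perm.mul_apply, swap_apply_left]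
  have := hG.dist_triangle (u := a) (v := σ a) (w := y)
  rw [SimpleGraph.dist_eq_one_iff_adj.2 hxy] at this
  omega

/-- Follow the tokens: start from the identity, of cost 0, and compose with the transposition of
each slide. -/
theorem IsReconfSeq.minTS_le (hG : G.Connected) {r q : ℕ} {s : ℕ → Finset V}
    (h : IsReconfSeq .TS G r D D' q s) : minTS G D D' ≤ q := by
  have key : ∀ i ≤ q, ∃ σ : Perm V, D.image σ = s i ∧ cost G σ D ≤ i := by
    intro i
    induction i with
    | zero => exact fun _ => ⟨1, by simp [h.first], by simp [cost]⟩
    | succ i ih =>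
      intro hi
      obtain ⟨σ, hσ, hc⟩ := ih (by omega)
      obtain ⟨x, hx, y, hy, hxy, e⟩ := (h.step i hi).exists_eq_insert_erase
      refine ⟨swap x y * σ, ?_, ?_⟩
      · rw [e, ← image_swap_eq_insert_erase hx hy, ← hσ, image_image]
        rfl
      · rw [← hσ] at hx hy
        exact (cost_swap_mul_le hG hxy hx hy).trans (by omega)
  obtain ⟨σ, hσ, hc⟩ := key q le_rfl
  rw [h.last] at hσ
  exact (minTS_le_cost hG hσ).trans (by exact_mod_cast hc)

/-- Swapping the targets of the tokens `u` and `v`. -/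
theorem image_mul_swap {u v : V} (hu : u ∈ D) (hv : v ∈ D) :
    D.image (σ * swap u v) = D.image σ := by
  have : D.image (swap u v) = D := by
    ext z
    simp only [mem_image]
    constructor
    · rintro ⟨a, ha, rfl⟩
      rw [swap_apply_def]
      grind
    · intro h
      refine ⟨swap u v z, ?_, swap_apply_self _ _ _⟩
      rw [swap_apply_def]
      grind
  rw [Perm.coe_mul, ← image_image, this]

theorem cost_mul_swap_add {u v : V} (hu : u ∈ D) (hv : v ∈ D) (huv : u ≠ v) :
    cost G (σ * swap u v) D + (G.dist u (σ u) + G.dist v (σ v)) =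
      cost G σ D + (G.dist u (σ v) + G.dist v (σ u)) := by
  have hv' : v ∈ D.erase u := mem_erase.2 ⟨huv.symm, hv⟩
  have h : ∀ w ∈ (D.erase u).erase v, G.dist w ((σ * swap u v) w) = G.dist w (σ w) := by
    intro w hw
    simp only [mem_erase] at hw
    rw [Perm.mul_apply, swap_apply_of_ne_of_ne hw.2.1 hw.1]
  rw [cost, cost, ← add_sum_erase _ _ hu, ← add_sum_erase _ _ hu, ← add_sum_erase _ _ hv',
    ← add_sum_erase _ _ hv', sum_congr rfl h]
  simp only [Perm.mul_apply, swap_apply_left, swap_apply_right]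
  omega

theorem image_mul_swap_insert_erase {x y : V} (hx : x ∈ D) (hy : y ∉ D) :
    (insert y (D.erase x)).image (σ * swap x y) = D.image σ := by
  rw [← image_swap_eq_insert_erase hx hy, image_image]
  congr 1
  ext z
  simp

theorem cost_mul_swap_insert_erase_add {x y : V} (hx : x ∈ D) (hy : y ∉ D) :
    cost G (σ * swap x y) (insert y (D.erase x)) + G.dist x (σ x) =
      cost G σ D + G.dist y (σ x) := by
  have h : ∀ w ∈ D.erase x, G.dist w ((σ * swap x y) w) = G.dist w (σ w) := by
    intro w hw
    simp only [mem_erase] at hw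
    rw [Perm.mul_apply, swap_apply_of_ne_of_ne hw.1 (by rintro rfl; exact hy hw.2)]
  rw [cost, cost, sum_insert (by simp [hy]), ← add_sum_erase _ _ hx, sum_congr rfl h,
    Perm.mul_apply, swap_apply_right]
  omega

/-- A slide along a shortest path to the target decreases the cost. -/
theorem exists_cost_add_one_eq {x y : V} (hx : x ∈ D) (hy : y ∉ D) (h : D.image σ = D')
    (hd : G.dist y (σ x) + 1 = G.dist x (σ x)) :
    ∃ τ : Perm V, (insert y (D.erase x)).image τ = D' ∧
      cost G τ (insert y (D.erase x)) + 1 = cost G σ D := by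
  refine ⟨σ * swap x y, (image_mul_swap_insert_erase hx hy).trans h, ?_⟩
  have := cost_mul_swap_insert_erase_add (G := G) (σ := σ) hx hy
  omega

/-- Two tokens may exchange their targets if one of them is on a shortest path of the other. -/
theorem cost_mul_swap_le (hG : G.Connected) {u v : V} (hu : u ∈ D) (hv : v ∈ D)
    (hd : G.dist u v + G.dist v (σ u) = G.dist u (σ u)) :
    cost G (σ * swap u v) D ≤ cost G σ D := by
  rcases eq_or_ne u v with rfl | huv
  · rw [swap_self]
    exact le_rfl
  · have := cost_mul_swap_add (G := G) (σ := σ) hu hv huv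
    have := hG.dist_triangle (u := u) (v := v) (w := σ v)
    omega

/-- Let `y` be the next vertex on a shortest path from `u` to its free target. If `y` is free, slide
there. If it is occupied, exchanging targets costs nothing, and the token at `y` is now closer to
that free target; hence the induction on the distance. -/
theorem exists_step_cost_of_apply_notMem (hG : G.Connected) {u : V} (hu : u ∈ D) (hσu : σ u ∉ D)
    (h : D.image σ = D') :
    ∃ D₁, Step .TS G D D₁ ∧ ∃ τ : Perm V, D₁.image τ = D' ∧ cost G τ D₁ + 1 ≤ cost G σ D := by
  induction hd : G.dist u (σ u) generalizing u σ with
  | zero =>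
    rw [hG.dist_eq_zero_iff] at hd
    exact absurd (hd ▸ hu) hσu
  | succ d ih =>
    obtain ⟨y, hxy, hy⟩ := exists_adj_dist_add_one hG (x := u) (t := σ u)
      (fun e => hσu (e ▸ hu))
    by_cases hyD : y ∈ D
    · have e : (σ * swap u y) y = σ u := by simp
      obtain ⟨D₁, h1, τ, h2, h3⟩ := ih (σ := σ * swap u y) hyD (by rwa [e])
        ((image_mul_swap hu hyD).trans h) (by rw [e]; omega)
      refine ⟨D₁, h1, τ, h2, h3.trans (cost_mul_swap_le hG hu hyD ?_)⟩
      rw [SimpleGraph.dist_eq_one_iff_adj.2 hxy]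
      omega
    · obtain ⟨τ, h1, h2⟩ := exists_cost_add_one_eq hu hyD h hy
      exact ⟨_, Step.insert_erase hu hyD hxy, τ, h1, h2.le⟩

theorem exists_step_cost (hG : G.Connected) (h : D.image σ = D') (hne : D ≠ D') :
    ∃ D₁, Step .TS G D D₁ ∧ ∃ τ : Perm V, D₁.image τ = D' ∧ cost G τ D₁ + 1 ≤ cost G σ D := by
  have hcard : D'.card = D.card := by rw [← h, card_image_of_injective _ σ.injective]
  obtain ⟨v, hv, hvD⟩ := not_subset.1
    fun hs : D' ⊆ D => hne (eq_of_subset_of_card_le hs hcard.ge).symm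
  rw [← h] at hv
  obtain ⟨u, hu, rfl⟩ := mem_image.1 hv
  exact exists_step_cost_of_apply_notMem hG hu hvD h

/-- A matching may be assumed to fix the common tokens. -/
theorem exists_cost_le_fixing (hG : G.Connected) (h : D.image σ = D') :
    ∃ τ : Perm V, D.image τ = D' ∧ cost G τ D ≤ cost G σ D ∧ ∀ u ∈ D, u ∈ D' → τ u = u := by
  induction hn : #{u ∈ D | σ u ≠ u} using Nat.strong_induction_on generalizing σ with
  | _ n ih =>
    by_cases hf : ∀ u ∈ D, u ∈ D' → σ u = u
    · exact ⟨σ, h, le_rfl, hf⟩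
    push Not at hf
    obtain ⟨u, hu, huD', hne⟩ := hf
    rw [← h] at huD'
    obtain ⟨w, hw, rfl⟩ := mem_image.1 huD'
    -- After the exchange `σ w` is sent to itself, while no fixed token is disturbed because `w` and
    -- `σ w` were both moved by `σ`.
    have hlt : #{z ∈ D | (σ * swap w (σ w)) z ≠ z} < n := by
      rw [← hn]
      refine card_lt_card ((ssubset_iff_of_subset fun z hz => ?_).2 ⟨σ w, ?_, ?_⟩)
      · rw [mem_filter] at hz ⊢
        refine ⟨hz.1, fun e => hz.2 ?_⟩
        have h1 : z ≠ w := by rintro rfl; exact hne (by rw [e, e])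
        have h2 : z ≠ σ w := by rintro rfl; exact hne e
        rw [Perm.mul_apply, swap_apply_of_ne_of_ne h1 h2, e]
      · exact mem_filter.2 ⟨hu, hne⟩
      · rw [mem_filter]
        simp
    obtain ⟨τ, h1, h2, h3⟩ := ih _ hlt ((image_mul_swap hw hu).trans h) rfl
    exact ⟨τ, h1, h2.trans (cost_mul_swap_le hG hw hu (by simp)), h3⟩

end Matchings

/-! ### Domination in split graphs and the upper bound for sliding. -/

section SplitGraphs

variable {V : Type*} {G : SimpleGraph V} {K S : Set V}

theorem IsSplitPartition.mem_left_of_adj (hs : IsSplitPartition G K S) {x y : V}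
    (hxy : G.Adj x y) (hx : x ∉ K) : y ∈ K := by
  by_contra hy
  rw [← Set.mem_compl_iff, hs.isCompl.compl_eq] at hx hy
  exact hs.isIndepSet hx hy hxy.ne hxy

theorem IsSplitPartition.dist_le_one (hs : IsSplitPartition G K S) {x y : V}
    (hx : x ∈ K) (hy : y ∈ K) : G.dist x y ≤ 1 := by
  rcases eq_or_ne x y with rfl | h
  · simp
  · exact (SimpleGraph.dist_eq_one_iff_adj.2 (hs.isClique hx hy h)).le

theorem IsSplitPartition.dist_le_two (hs : IsSplitPartition G K S) (hG : G.Connected) {p : V}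
    (hp : p ∈ K) (u : V) : G.dist u p ≤ 2 := by
  by_cases hu : u ∈ K
  · exact (hs.dist_le_one hu hp).trans one_le_two
  · obtain ⟨y, huy, hd⟩ := exists_adj_dist_add_one hG (fun e : u = p => hu (e ▸ hp))
    have := hs.dist_le_one (hs.mem_left_of_adj huy hu) hp
    omega

theorem isDistDominating_iff_dist (hG : G.Connected) {r : ℕ} {D : Finset V} :
    IsDistDominating G r D ↔ ∀ u, ∃ v ∈ D, G.dist u v ≤ r := by
  refine forall_congr' fun u => exists_congr fun v => and_congr_right fun _ => ?_
  rw [← (hG u v).coe_dist_eq_edist, Nat.cast_le]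

/-- This is the only way domination is checked while a token sits on the clique. -/
theorem IsSplitPartition.isDistDominating_of_mem (hs : IsSplitPartition G K S)
    (hG : G.Connected) {D : Finset V} {p : V} (hpD : p ∈ D) (hp : p ∈ K) :
    IsDistDominating G 2 D :=
  (isDistDominating_iff_dist hG).2 fun u => ⟨p, hpD, hs.dist_le_two hG hp u⟩

/-- The graph is then a star or a point, of diameter at most 2. This covers the case where the
blocker has no second clique vertex to step aside to. -/
theorem IsSplitPartition.isDistDominating_of_subsingleton (hs : IsSplitPartition G K S)
    (hG : G.Connected) (hK : K.Subsingleton) {D : Finset V} (hD : D.Nonempty) :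
    IsDistDominating G 2 D := by
  obtain ⟨v, hv⟩ := hD
  refine (isDistDominating_iff_dist hG).2 fun u => ⟨v, hv, ?_⟩
  by_cases hvK : v ∈ K
  · exact hs.dist_le_two hG hvK u
  by_cases huK : u ∈ K
  · rw [SimpleGraph.dist_comm]
    exact hs.dist_le_two hG huK v
  rcases eq_or_ne u v with rfl | h
  · simp
  obtain ⟨y, huy, -⟩ := exists_adj_dist_add_one hG h
  obtain ⟨z, hvz, -⟩ := exists_adj_dist_add_one hG h.symm
  obtain rfl := hK (hs.mem_left_of_adj huy huK) (hs.mem_left_of_adj hvz hvK)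
  have := hG.dist_triangle (u := u) (v := y) (w := v)
  rw [SimpleGraph.dist_eq_one_iff_adj.2 huy, SimpleGraph.dist_eq_one_iff_adj.2 hvz.symm] at this
  omega

variable [DecidableEq V] {D D' : Finset V} {σ : Perm V}

/-- Without a domination constraint the greedy slides reach the target with no waste. -/
theorem opt_TS_le_cost (hG : G.Connected) {r : ℕ}
    (hdom : ∀ D : Finset V, D.Nonempty → IsDistDominating G r D) (hD : D.Nonempty)
    (h : D.image σ = D') : opt .TS G r D D' ≤ cost G σ D := by
  induction hn : cost G σ D using Nat.strong_induction_on generalizing D σ with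
  | _ n ih =>
    by_cases hne : D = D'
    · rw [← hne, opt_self (hdom D hD)]
      exact zero_le
    · obtain ⟨D₁, hstep, τ, hτ, hc⟩ := exists_step_cost hG h hne
      have hD₁ : D₁.Nonempty := by
        obtain ⟨x, -, y, -, -, rfl⟩ := hstep.exists_eq_insert_erase
        exact insert_nonempty _ _
      calc opt .TS G r D D' ≤ opt .TS G r D D₁ + opt .TS G r D₁ D' := opt_triangle
        _ ≤ 1 + (cost G τ D₁ : ℕ) :=
          add_le_add (opt_le_one (hdom D hD) (hdom D₁ hD₁) hstep) (ih _ (by omega) hD₁ hτ rfl)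
        _ ≤ n := by exact_mod_cast (by omega : 1 + cost G τ D₁ ≤ n)

/-- If a token stays at `q ∈ K` and all tokens to be moved, as well as their targets, are
neighbours of a free vertex `p`, then two slides for each of them suffice. -/
theorem IsSplitPartition.opt_TS_le_two_mul (hs : IsSplitPartition G K S) (hG : G.Connected)
    {p q : V} (hq : q ∈ K) (hqD : q ∈ D) (hqD' : q ∈ D') (hpD : p ∉ D) (hpD' : p ∉ D')
    (hcard : D.card = D'.card) (hD : ∀ u ∈ D, u ∉ D' → G.Adj u p)
    (hD' : ∀ v ∈ D', v ∉ D → G.Adj p v) : opt .TS G 2 D D' ≤ (2 * #(D \ D') : ℕ) := by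
  induction hn : #(D \ D') generalizing D with
  | zero =>
    have hsub : D ⊆ D' := sdiff_eq_empty_iff_subset.1 (card_eq_zero.1 hn)
    rw [eq_of_subset_of_card_le hsub hcard.ge, opt_self (hs.isDistDominating_of_mem hG hqD' hq)]
    exact zero_le
  | succ n ih =>
    obtain ⟨u, hu⟩ : (D \ D').Nonempty := card_pos.1 (by omega)
    obtain ⟨v, hv⟩ : (D' \ D).Nonempty := by
      rw [← card_pos, ← card_sdiff_comm hcard]
      omega
    rw [mem_sdiff] at hu hv
    have hup := hD u hu.1 hu.2
    have hpv := hD' v hv.1 hv.2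
    have hqu : q ≠ u := by rintro rfl; exact hu.2 hqD'
    have hqv : q ≠ v := by rintro rfl; exact hv.2 hqD
    have hqp : q ≠ p := by rintro rfl; exact hpD hqD
    have e : insert v ((insert p (D.erase u)).erase p) = insert v (D.erase u) := by
      rw [erase_insert (by simp [hpD])]
    -- The token at `u` reaches `v` via `p`, which is free again afterwards. Any `u` may be paired
    -- with any `v`, since all are neighbours of `p`.
    have s1 : Step .TS G D (insert p (D.erase u)) := Step.insert_erase hu.1 hpD hup
    have s2 : Step .TS G (insert p (D.erase u)) (insert v (D.erase u)) := by
      rw [← e]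
      exact Step.insert_erase (mem_insert_self _ _) (by simp [hv.2, hpv.ne']) hpv
    have d0 := hs.isDistDominating_of_mem hG hqD hq
    have d1 : IsDistDominating G 2 (insert p (D.erase u)) :=
      hs.isDistDominating_of_mem hG (by simp [hqu, hqD]) hq
    have hq2 : q ∈ insert v (D.erase u) := by simp [hqu, hqD]
    have d2 := hs.isDistDominating_of_mem hG hq2 hq
    have hrec := ih (D := insert v (D.erase u)) hq2 (by simp [hpD, hpv.ne])
      (by rw [card_insert_of_notMem (by simp [hv.2]), card_erase_add_one hu.1, hcard])
      (by simp only [mem_insert, mem_erase]; grind)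
      (by simp only [mem_insert, mem_erase]; grind)
      (by
        rw [insert_erase_sdiff hv.1, card_erase_of_mem (mem_sdiff.2 hu), hn]
        rfl)
    calc opt .TS G 2 D D' ≤ opt .TS G 2 D (insert p (D.erase u)) +
          (opt .TS G 2 (insert p (D.erase u)) (insert v (D.erase u)) +
            opt .TS G 2 (insert v (D.erase u)) D') :=
          opt_triangle.trans (add_le_add le_rfl opt_triangle)
      _ ≤ 1 + (1 + (2 * n : ℕ)) :=
          add_le_add (opt_le_one d0 d1 s1) (add_le_add (opt_le_one d1 d2 s2) hrec)
      _ = (2 * (n + 1) : ℕ) := by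
          push_cast
          ring

/-- The remaining case of the greedy algorithm: the only token on `K` is at `p`, and it can only
leave `K`, while the other tokens have to pass through `p`. -/
theorem IsSplitPartition.opt_TS_le_of_blocked (hs : IsSplitPartition G K S) (hG : G.Connected)
    {p q : V} (hp : p ∈ K) (hpD : p ∈ D) (hq : q ∈ K) (hqp : q ≠ p)
    (hK : ∀ u ∈ D, u ∈ K → u = p) (h : D.image σ = D') (hdom : IsDistDominating G 2 D')
    (hσ : ∀ u ∈ D, u ≠ p → σ u ≠ u →
      G.Adj u p ∧ G.Adj p (σ u) ∧ σ u ∉ K ∧ G.dist u (σ u) = 2)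
    (hσp : σ p ≠ p → G.Adj p (σ p) ∧ σ p ∉ K) :
    opt .TS G 2 D D' ≤ (cost G σ D : ℕ∞) + 2 := by
  have hqD : q ∉ D := fun hqD => hqp (hK q hqD hq)
  have hqD' : q ∉ D' := by
    rw [← h, mem_image]
    rintro ⟨u, hu, rfl⟩
    by_cases hup : u = p
    · subst hup
      exact (hσp hqp).2 hq
    · by_cases huu : σ u = u
      · exact hup (hK u hu (huu ▸ hq))
      · exact (hσ u hu hup huu).2.2.1 hq
  have hσpD' : σ p ∈ D' := h ▸ mem_image_of_mem σ hpD
  have hpD' : p ∉ D'.erase (σ p) := by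
    rw [mem_erase, ← h, mem_image]
    rintro ⟨hne, u, hu, e⟩
    have hup : u ≠ p := by
      rintro rfl
      exact hne e.symm
    have := (hσ u hu hup (by rw [e]; exact hup.symm)).2.1
    rw [e] at this
    exact G.irrefl this
  have hcard : D'.card = D.card := by rw [← h, card_image_of_injective _ σ.injective]
  -- Waypoints: `p` slides to `q` (`D₁`), the others pass through `p` (`D₂`), `q` returns to `p`
  -- (`D₃`), and `p` goes to its own target (`D'`). Only the two slides along `pq` are not paid for
  -- by the cost.
  set D₁ := insert q (D.erase p) with hD₁
  set D₂ := insert q (D'.erase (σ p)) with hD₂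
  set D₃ := insert p (D'.erase (σ p)) with hD₃
  have d0 : IsDistDominating G 2 D := hs.isDistDominating_of_mem hG hpD hp
  have d1 : IsDistDominating G 2 D₁ := hs.isDistDominating_of_mem hG (mem_insert_self _ _) hq
  have d2 : IsDistDominating G 2 D₂ := hs.isDistDominating_of_mem hG (mem_insert_self _ _) hq
  have d3 : IsDistDominating G 2 D₃ := hs.isDistDominating_of_mem hG (mem_insert_self _ _) hp
  have h01 : opt .TS G 2 D D₁ ≤ 1 :=
    opt_le_one d0 d1 (Step.insert_erase hpD hqD (hs.isClique hp hq hqp.symm))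
  have h12 : opt .TS G 2 D₁ D₂ ≤ (2 * #(D₁ \ D₂) : ℕ) := by
    refine hs.opt_TS_le_two_mul hG (p := p) hq (mem_insert_self _ _) (mem_insert_self _ _)
      (by simp [hD₁, hqp.symm]) ?_ ?_ ?_ ?_
    · rw [hD₂, mem_insert]
      exact fun e => e.elim (fun e => hqp e.symm) hpD'
    · rw [hD₁, hD₂, card_insert_of_notMem (by simp [hqD]), card_insert_of_notMem (by simp [hqD']),
        card_erase_add_one hpD, card_erase_add_one hσpD', hcard]
    · intro u hu hu'
      simp only [hD₁, hD₂, mem_insert, mem_erase, not_or, not_and] at hu hu'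
      obtain ⟨hup, huD⟩ := hu.resolve_left hu'.1
      refine (hσ u huD hup fun e => hu'.2 ?_ (h ▸ mem_image.2 ⟨u, huD, e⟩)).1
      rw [← e]
      exact fun e' => hup (σ.injective e')
    · intro v hv hv'
      simp only [hD₁, hD₂, mem_insert, mem_erase, not_or, not_and] at hv hv'
      obtain ⟨hvp, hvD'⟩ := hv.resolve_left hv'.1
      rw [← h] at hvD'
      obtain ⟨u, hu, rfl⟩ := mem_image.1 hvD'
      have hup : u ≠ p := fun e => hvp (by rw [e])
      exact (hσ u hu hup fun e => hv'.2 (by rwa [e]) (by rwa [e])).2.1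
  have h23 : opt .TS G 2 D₂ D₃ ≤ 1 := by
    refine opt_le_one d2 d3 ?_
    have : D₃ = insert p (D₂.erase q) := by
      rw [hD₃, hD₂, erase_insert (by simp [hqD'])]
    rw [this]
    refine Step.insert_erase (mem_insert_self _ _) ?_ (hs.isClique hq hp hqp)
    rw [hD₂, mem_insert]
    exact fun e => e.elim (fun e => hqp e.symm) hpD'
  have h34 : opt .TS G 2 D₃ D' ≤ (G.dist p (σ p) : ℕ) := by
    by_cases hpp : σ p = p
    · have : D₃ = D' := by
        rw [hpp] at hσpD'
        rw [hD₃, hpp, insert_erase hσpD']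
      rw [this, opt_self hdom]
      exact zero_le
    · obtain ⟨hadj, -⟩ := hσp hpp
      rw [SimpleGraph.dist_eq_one_iff_adj.2 hadj, Nat.cast_one]
      refine opt_le_one d3 hdom ?_
      have : D' = insert (σ p) (D₃.erase p) := by
        rw [hD₃, erase_insert hpD', insert_erase hσpD']
      conv_rhs => rw [this]
      exact Step.insert_erase (mem_insert_self _ _) (by simp [hD₃, hpp]) hadj
  have hcost : G.dist p (σ p) + 2 * #(D₁ \ D₂) ≤ cost G σ D := by
    rw [cost, ← add_sum_erase _ _ hpD, mul_comm 2]
    refine Nat.add_le_add_left ?_ _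
    have hsub : D₁ \ D₂ ⊆ D.erase p := by
      intro u
      simp only [hD₁, hD₂, mem_sdiff, mem_insert, mem_erase]
      grind
    refine le_trans ?_ (sum_le_sum_of_subset hsub)
    rw [← smul_eq_mul]
    refine card_nsmul_le_sum _ _ _ fun u hu => ?_
    have hu1 := mem_erase.1 (hsub hu)
    refine (hσ u hu1.2 hu1.1 fun e => ?_).2.2.2.ge
    simp only [hD₁, hD₂, mem_sdiff, mem_insert, mem_erase, not_or, not_and] at hu
    refine hu.2.2 ?_ (h ▸ mem_image.2 ⟨u, hu1.2, e⟩)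
    rw [← e]
    exact fun e' => hu1.1 (σ.injective e')
  calc opt .TS G 2 D D' ≤ opt .TS G 2 D D₁ + (opt .TS G 2 D₁ D₂ +
        (opt .TS G 2 D₂ D₃ + opt .TS G 2 D₃ D')) :=
        opt_triangle.trans (add_le_add le_rfl (opt_triangle.trans
          (add_le_add le_rfl opt_triangle)))
    _ ≤ 1 + ((2 * #(D₁ \ D₂) : ℕ) + (1 + (G.dist p (σ p) : ℕ))) := by gcongr
    _ ≤ (cost G σ D : ℕ∞) + 2 := by exact_mod_cast (by omega)

/-- Induction on the cost, by contradiction: if the bound fails, no cost-decreasing slide keeps a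
token on `K`, and this rigidity yields exactly the blocked configuration. -/
theorem IsSplitPartition.opt_TS_le_cost_add_two_of_mem (hs : IsSplitPartition G K S)
    (hG : G.Connected) (hdom : IsDistDominating G 2 D') {p : V} (hpD : p ∈ D) (hp : p ∈ K)
    (h : D.image σ = D') : opt .TS G 2 D D' ≤ (cost G σ D : ℕ∞) + 2 := by
  induction hn : cost G σ D using Nat.strong_induction_on generalizing D σ p with
  | _ n ih =>
    have d0 := hs.isDistDominating_of_mem hG hpD hp
    by_contra hopt
    have next : ∀ D₁ : Finset V, ∀ τ : Perm V, ∀ p₁ ∈ D₁, p₁ ∈ K → D₁.image τ = D' →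
        cost G τ D₁ + 1 ≤ n → ¬ Step .TS G D D₁ := by
      intro D₁ τ p₁ hp₁ hp₁K hτ hc hstep
      refine hopt ?_
      calc opt .TS G 2 D D' ≤ opt .TS G 2 D D₁ + opt .TS G 2 D₁ D' := opt_triangle
        _ ≤ 1 + ((cost G τ D₁ : ℕ) + 2) :=
          add_le_add (opt_le_one d0 (hs.isDistDominating_of_mem hG hp₁ hp₁K) hstep)
            (ih _ (by omega) hp₁ hp₁K hτ rfl)
        _ ≤ (n : ℕ∞) + 2 := by exact_mod_cast (by omega)
    have hne : D ≠ D' := by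
      intro e
      rw [← e, opt_self d0] at hopt
      exact hopt zero_le
    have hK : ∀ u ∈ D, u ∈ K → u = p := by
      intro p₂ hp₂ hp₂K
      by_contra hpp
      -- With two tokens on `K`, any greedy slide leaves one of them in place.
      obtain ⟨D₁, hstep, τ, hτ, hc⟩ := exists_step_cost hG h hne
      obtain ⟨x, hx, y, hy, -, rfl⟩ := hstep.exists_eq_insert_erase
      by_cases hxp : x = p
      · exact next _ τ p₂ (by subst hxp; simp [hpp, hp₂]) hp₂K hτ (by omega) hstep
      · exact next _ τ p (by simp [Ne.symm hxp, hpD]) hp hτ (by omega) hstep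
    by_cases hKs : K.Subsingleton
    · refine hopt ((opt_TS_le_cost hG (fun D hD =>
        hs.isDistDominating_of_subsingleton hG hKs hD) ⟨p, hpD⟩ h).trans ?_)
      rw [hn]
      exact le_self_add
    obtain ⟨q, hq, hqp⟩ := (Set.not_subsingleton_iff.1 hKs).exists_ne p
    obtain ⟨τ, hτ, hτc, hfix⟩ := exists_cost_le_fixing hG h
    have slide : ∀ τ : Perm V, ∀ x ∈ D, ∀ y, D.image τ = D' → cost G τ D ≤ n → G.Adj x y →
        G.dist y (τ x) + 1 = G.dist x (τ x) → (y ∈ K ∨ x ≠ p) → y ∈ D := by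
      intro τ x hx y hτ hτc hxy hd hor
      by_contra hy
      obtain ⟨τ', h1, h2⟩ := exists_cost_add_one_eq hx hy hτ hd
      have hstep : Step .TS G D _ := Step.insert_erase hx hy hxy
      rcases hor with hyK | hxp
      · exact next _ τ' y (mem_insert_self _ _) hyK h1 (by omega) hstep
      · exact next _ τ' p (by simp [Ne.symm hxp, hpD]) hp h1 (by omega) hstep
    -- The first vertex `z` of a shortest path from `p` lies outside `K`, as otherwise it would be a
    -- second occupied clique vertex. A path continuing beyond `z` would re-enter `K`, which the
    -- distance bounds 1 and 2 exclude; so `z` is the target. This is proved for all cheap `τ`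
    -- because it is also applied after an exchange of targets.
    have leaf : ∀ τ : Perm V, D.image τ = D' → cost G τ D ≤ n → τ p ≠ p →
        G.Adj p (τ p) ∧ τ p ∉ K := by
      intro τ hτ hτc hne
      obtain ⟨z, hpz, hd⟩ := exists_adj_dist_add_one hG hne.symm
      have hzK : z ∉ K := by
        intro hzK
        exact hpz.ne' (hK z (slide τ p hpD z hτ hτc hpz hd (Or.inl hzK)) hzK)
      by_cases hz : z = τ p
      · exact hz ▸ ⟨hpz, hzK⟩
      · exfalso
        obtain ⟨a, hza, hd'⟩ := exists_adj_dist_add_one hG hz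
        have ha := hs.mem_left_of_adj hza hzK
        by_cases hτK : τ p ∈ K
        · have := hs.dist_le_one hp hτK
          omega
        · have h2 := hs.dist_le_two hG hp (τ p)
          rw [SimpleGraph.dist_comm] at h2
          have h0 : G.dist a (τ p) = 0 := by omega
          rw [hG.dist_eq_zero_iff] at h0
          exact hτK (h0 ▸ ha)
    refine hopt (le_trans (hs.opt_TS_le_of_blocked hG hp hpD hq hqp hK hτ hdom ?_
      (leaf τ hτ (by omega))) (add_le_add (by exact_mod_cast (by omega)) le_rfl))
    intro u hu hup huu
    have huK : u ∉ K := fun huK => hup (hK u hu huK)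
    obtain ⟨y, huy, hd⟩ := exists_adj_dist_add_one hG (Ne.symm huu)
    obtain rfl := hK y (slide τ u hu y hτ (by omega) huy hd (Or.inr hup))
      (hs.mem_left_of_adj huy huK)
    have hd1 := SimpleGraph.dist_eq_one_iff_adj.2 huy
    -- From here on `y` is the clique token. Were it the target of `u`, it would be a common token,
    -- hence fixed by `τ`, against injectivity.
    have huy' : τ u ≠ y := by
      intro e
      have := hfix y hpD (hτ ▸ mem_image.2 ⟨u, hu, e⟩)
      exact hup (τ.injective (e.trans this.symm))
    have e : (τ * swap u y) y = τ u := by simp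
    -- After the exchange the clique token inherits the target of `u`, so that target is a neighbour
    -- outside `K`.
    have := leaf (τ * swap u y) ((image_mul_swap hu hpD).trans hτ)
      ((cost_mul_swap_le hG hu hpD (by omega)).trans (by omega)) (by rwa [e])
    rw [e] at this
    refine ⟨huy, this.1, this.2, ?_⟩
    rw [← hd, SimpleGraph.dist_eq_one_iff_adj.2 this.1]

/-- If all tokens are outside `K`, every slide enters `K`; a greedy one is paid for by the drop in
cost. -/
theorem IsSplitPartition.opt_TS_le_cost_add_two (hs : IsSplitPartition G K S)
    (hG : G.Connected) (hD : IsDistDominating G 2 D) (hD' : IsDistDominating G 2 D')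
    (h : D.image σ = D') : opt .TS G 2 D D' ≤ (cost G σ D : ℕ∞) + 2 := by
  by_cases hK : ∃ p ∈ D, p ∈ K
  · obtain ⟨p, hpD, hp⟩ := hK
    exact hs.opt_TS_le_cost_add_two_of_mem hG hD' hpD hp h
  push Not at hK
  by_cases hne : D = D'
  · rw [← hne, opt_self hD]
    exact zero_le
  obtain ⟨D₁, hstep, τ, hτ, hc⟩ := exists_step_cost hG h hne
  obtain ⟨x, hx, y, hy, hxy, e⟩ := hstep.exists_eq_insert_erase
  have hyK := hs.mem_left_of_adj hxy (hK x hx)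
  have hyD : y ∈ D₁ := e ▸ mem_insert_self _ _
  calc opt .TS G 2 D D' ≤ opt .TS G 2 D D₁ + opt .TS G 2 D₁ D' := opt_triangle
    _ ≤ 1 + ((cost G τ D₁ : ℕ) + 2) :=
      add_le_add (opt_le_one hD (hs.isDistDominating_of_mem hG hyD hyK) hstep)
        (hs.opt_TS_le_cost_add_two_of_mem hG hD' hyD hyK hτ)
    _ ≤ (cost G σ D : ℕ∞) + 2 := by exact_mod_cast (by omega)

end SplitGraphs

/-! ### Bounds for token jumping. -/

section TokenJumping

variable {V : Type*} [DecidableEq V] {G : SimpleGraph V} {K S : Set V} {D D' : Finset V}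

theorem minTJ_eq_card_sdiff (h : D.card = D'.card) : minTJ D D' = #(D \ D') := by
  have h1 := two_mul_minTJ h
  have h2 : #(symmDiff D D') = #(D \ D') + #(D' \ D) := by
    rw [symmDiff_def, sup_eq_union, card_union_of_disjoint disjoint_sdiff_sdiff]
  have h3 := card_sdiff_comm h
  omega

theorem IsReconfSeq.card_sdiff_le {R : Rule} {r q : ℕ} {s : ℕ → Finset V}
    (h : IsReconfSeq R G r D D' q s) {i : ℕ} (hi : i ≤ q) : #(s i \ D') ≤ q - i := by
  induction hn : q - i generalizing i with
  | zero =>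
    obtain rfl : i = q := by omega
    simp [h.last]
  | succ n ih =>
    obtain ⟨x, hx, y, hy, -, e⟩ := (h.step i (by omega)).exists_eq_insert_erase
    have hsub : s i \ D' ⊆ insert x (s (i + 1) \ D') := by
      intro z
      simp only [e, mem_sdiff, mem_insert, mem_erase]
      tauto
    exact (card_le_card hsub).trans ((card_insert_le _ _).trans
      (Nat.succ_le_succ (ih (by omega) (by omega))))

theorem IsSplitPartition.opt_TJ_le_of_common (hs : IsSplitPartition G K S) (hG : G.Connected)
    {c : V} (hc : c ∈ K) (hcD : c ∈ D) (hcD' : c ∈ D') (hcard : D.card = D'.card) :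
    opt .TJ G 2 D D' ≤ (#(D \ D') : ℕ) := by
  induction hn : #(D \ D') generalizing D with
  | zero =>
    have hsub : D ⊆ D' := sdiff_eq_empty_iff_subset.1 (card_eq_zero.1 hn)
    rw [eq_of_subset_of_card_le hsub hcard.ge, opt_self (hs.isDistDominating_of_mem hG hcD' hc)]
    exact zero_le
  | succ n ih =>
    obtain ⟨u, hu⟩ : (D \ D').Nonempty := card_pos.1 (by omega)
    obtain ⟨v, hv⟩ : (D' \ D).Nonempty := by
      rw [← card_pos, ← card_sdiff_comm hcard]
      omega
    have hu' := mem_sdiff.1 hu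
    have hv' := mem_sdiff.1 hv
    have hcu : c ≠ u := by rintro rfl; exact hu'.2 hcD'
    have hc1 : c ∈ insert v (D.erase u) := by simp [hcu, hcD]
    have hrec := ih hc1 (by
        rw [card_insert_of_notMem (by simp [hv'.2]), card_erase_add_one hu'.1, hcard])
      (by rw [insert_erase_sdiff hv'.1, card_erase_of_mem hu, hn]; rfl)
    calc opt .TJ G 2 D D' ≤ opt .TJ G 2 D (insert v (D.erase u)) +
          opt .TJ G 2 (insert v (D.erase u)) D' := opt_triangle
      _ ≤ 1 + (n : ℕ) := add_le_add (opt_le_one (hs.isDistDominating_of_mem hG hcD hc)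
          (hs.isDistDominating_of_mem hG hc1 hc) (Step.insert_erase hu'.1 hv'.2 trivial)) hrec
      _ = (n + 1 : ℕ) := by
          push_cast
          ring

/-- If `c` is not a target, reserve some `v ∈ D' \ D` for it: first reach `D'` with `v` replaced by
`c`, never moving `c`, then jump from `c` to `v`. -/
theorem IsSplitPartition.opt_TJ_le_of_mem (hs : IsSplitPartition G K S) (hG : G.Connected)
    {c : V} (hc : c ∈ K) (hcD : c ∈ D) (hD' : IsDistDominating G 2 D')
    (hcard : D.card = D'.card) : opt .TJ G 2 D D' ≤ (#(D \ D') : ℕ) := by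
  by_cases hcD' : c ∈ D'
  · exact hs.opt_TJ_le_of_common hG hc hcD hcD' hcard
  have hcm : c ∈ D \ D' := mem_sdiff.2 ⟨hcD, hcD'⟩
  have hpos : 0 < #(D \ D') := card_pos.2 ⟨c, hcm⟩
  obtain ⟨v, hv⟩ : (D' \ D).Nonempty := by
    rwa [← card_pos, ← card_sdiff_comm hcard]
  have hv' := mem_sdiff.1 hv
  have hcv : c ∉ D'.erase v := by simp [hcD']
  have hvc : v ≠ c := by rintro rfl; exact hv'.2 hcD
  have hcard' : #(insert c (D'.erase v)) = #D' := by
    rw [card_insert_of_notMem hcv, card_erase_add_one hv'.1]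
  have hsub : D \ insert c (D'.erase v) ⊆ (D \ D').erase c := by
    intro z
    simp only [mem_sdiff, mem_insert, mem_erase, not_or, not_and]
    rintro ⟨hz, hzc, hzv⟩
    exact ⟨hzc, hz, hzv fun e => hv'.2 (e ▸ hz)⟩
  have hle : #(D \ insert c (D'.erase v)) + 1 ≤ #(D \ D') := by
    have := card_le_card hsub
    rw [card_erase_of_mem hcm] at this
    omega
  have hstep : Step .TJ G (insert c (D'.erase v)) D' := by
    have e : D' = insert v ((insert c (D'.erase v)).erase c) := by
      rw [erase_insert hcv, insert_erase hv'.1]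
    conv_rhs => rw [e]
    exact Step.insert_erase (mem_insert_self _ _) (by simp [hvc]) trivial
  calc opt .TJ G 2 D D' ≤ opt .TJ G 2 D (insert c (D'.erase v)) +
        opt .TJ G 2 (insert c (D'.erase v)) D' := opt_triangle
    _ ≤ (#(D \ insert c (D'.erase v)) : ℕ) + 1 :=
        add_le_add (hs.opt_TJ_le_of_common hG hc hcD (mem_insert_self _ _)
          (hcard.trans hcard'.symm))
        (opt_le_one (hs.isDistDominating_of_mem hG (mem_insert_self _ _) hc) hD' hstep)
    _ ≤ (#(D \ D') : ℕ) := by exact_mod_cast hle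

/-- When `D` misses `K`, a misplaced token first jumps to a clique neighbour. This does not increase
the number of misplaced tokens, so exactly one move is lost. -/
theorem IsSplitPartition.opt_TJ_le_add_one (hs : IsSplitPartition G K S) (hG : G.Connected)
    (hD : IsDistDominating G 2 D) (hD' : IsDistDominating G 2 D')
    (hcard : D.card = D'.card) : opt .TJ G 2 D D' ≤ (#(D \ D') : ℕ) + 1 := by
  by_cases hK : ∃ c ∈ D, c ∈ K
  · obtain ⟨c, hcD, hc⟩ := hK
    exact (hs.opt_TJ_le_of_mem hG hc hcD hD' hcard).trans le_self_add
  push Not at hK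
  rcases Nat.eq_zero_or_pos #(D \ D') with h0 | hpos
  · have hsub : D ⊆ D' := sdiff_eq_empty_iff_subset.1 (card_eq_zero.1 h0)
    rw [eq_of_subset_of_card_le hsub hcard.ge, opt_self hD']
    exact zero_le
  obtain ⟨u, hu⟩ := card_pos.1 hpos
  obtain ⟨v, hv⟩ : (D' \ D).Nonempty := by
    rwa [← card_pos, ← card_sdiff_comm hcard]
  have hu' := mem_sdiff.1 hu
  have huv : u ≠ v := by rintro rfl; exact (mem_sdiff.1 hv).2 hu'.1
  obtain ⟨c, huc, -⟩ := exists_adj_dist_add_one hG huv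
  have hc : c ∈ K := hs.mem_left_of_adj huc (hK u hu'.1)
  have hcD : c ∉ D := fun h => hK c h hc
  have hsub : insert c (D.erase u) \ D' ⊆ insert c ((D \ D').erase u) := by
    intro z
    simp only [mem_sdiff, mem_insert, mem_erase]
    tauto
  have hle : #(insert c (D.erase u) \ D') ≤ #(D \ D') := by
    refine (card_le_card hsub).trans ((card_insert_le _ _).trans ?_)
    rw [card_erase_add_one hu]
  have hc1 : c ∈ insert c (D.erase u) := mem_insert_self _ _
  calc opt .TJ G 2 D D' ≤ opt .TJ G 2 D (insert c (D.erase u)) +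
        opt .TJ G 2 (insert c (D.erase u)) D' := opt_triangle
    _ ≤ 1 + (#(insert c (D.erase u) \ D') : ℕ) :=
        add_le_add (opt_le_one hD (hs.isDistDominating_of_mem hG hc1 hc)
          (Step.insert_erase hu'.1 hcD trivial))
        (hs.opt_TJ_le_of_mem hG hc hc1 hD' (by
          rw [card_insert_of_notMem (by simp [hcD]), card_erase_add_one hu'.1, hcard]))
    _ ≤ (#(D \ D') : ℕ) + 1 := by exact_mod_cast (by omega)

end TokenJumping

/-! ### The four inequalities for split instances. -/

section Bounds

variable {V : Type*} [DecidableEq V] {G : SimpleGraph V} {K S : Set V} {D D' : Finset V}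

theorem IsSplitInstance.minTS_le_opt (h : IsSplitInstance G K S 2 D D') :
    minTS G D D' ≤ opt .TS G 2 D D' :=
  le_opt fun _ _ hs => hs.minTS_le h.connected

theorem IsSplitInstance.opt_le_minTS_add_two [Finite V] (h : IsSplitInstance G K S 2 D D') :
    opt .TS G 2 D D' ≤ minTS G D D' + 2 := by
  obtain ⟨σ, hσ, hc⟩ := exists_cost_eq_minTS h.connected h.card_eq
  rw [← hc]
  exact h.split.opt_TS_le_cost_add_two h.connected h.source h.target hσ

theorem IsSplitInstance.minTJ_le_opt (h : IsSplitInstance G K S 2 D D') :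
    (minTJ D D' : ℕ∞) ≤ opt .TJ G 2 D D' := by
  rw [minTJ_eq_card_sdiff h.card_eq]
  refine le_opt fun q s hs => ?_
  have := hs.card_sdiff_le (Nat.zero_le q)
  rw [hs.first] at this
  exact_mod_cast this

theorem IsSplitInstance.opt_le_minTJ_add_one (h : IsSplitInstance G K S 2 D D') :
    opt .TJ G 2 D D' ≤ (minTJ D D' : ℕ∞) + 1 := by
  rw [minTJ_eq_card_sdiff h.card_eq]
  exact h.split.opt_TJ_le_add_one h.connected h.source h.target h.card_eq

end Bounds

/-! ### Split graphs given by an incidence relation. -/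

section SplitGraphOfRelation

variable {A B : Type*} {N : A → B → Prop}

/-- The split graph with clique `A` and independent set `B` in which `a ∈ A` and `b ∈ B` are
adjacent if and only if `N a b`. -/
def splitGraph (N : A → B → Prop) : SimpleGraph (A ⊕ B) where
  Adj
    | .inl a, .inl a' => a ≠ a'
    | .inl a, .inr b => N a b
    | .inr b, .inl a => N a b
    | .inr _, .inr _ => False
  symm := ⟨by
    rintro (a | b) (a' | b') h
    · exact Ne.symm h
    all_goals exact h⟩
  loopless := ⟨by
    rintro (a | b) h
    · exact h rfl
    · exact h⟩

theorem splitGraph_adj_inl_inl {a a' : A} :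
    (splitGraph N).Adj (.inl a) (.inl a') ↔ a ≠ a' := Iff.rfl

theorem splitGraph_adj_inl_inr {a : A} {b : B} :
    (splitGraph N).Adj (.inl a) (.inr b) ↔ N a b := Iff.rfl

theorem splitGraph_adj_inr_inl {a : A} {b : B} :
    (splitGraph N).Adj (.inr b) (.inl a) ↔ N a b := Iff.rfl

theorem splitGraph_not_adj_inr_inr {b b' : B} :
    ¬ (splitGraph N).Adj (.inr b) (.inr b') := id

theorem isSplitPartition_splitGraph :
    IsSplitPartition (splitGraph N) (Set.range Sum.inl) (Set.range Sum.inr) where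
  isCompl := Set.isCompl_range_inl_range_inr
  isClique := by
    rintro _ ⟨a, rfl⟩ _ ⟨a', rfl⟩ h
    exact fun e => h (by rw [e])
  isIndepSet := by
    rintro _ ⟨b, rfl⟩ _ ⟨b', rfl⟩ -
    exact id

theorem connected_splitGraph [Nonempty A] (h : ∀ b, ∃ a, N a b) : (splitGraph N).Connected := by
  obtain ⟨a₀⟩ := ‹Nonempty A›
  have hA : ∀ a, (splitGraph N).Reachable (.inl a) (.inl a₀) := by
    intro a
    rcases eq_or_ne a a₀ with rfl | ha
    · exact SimpleGraph.Reachable.refl _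
    · exact (splitGraph_adj_inl_inl.2 ha).reachable
  have hB : ∀ x, (splitGraph N).Reachable x (.inl a₀) := by
    rintro (a | b)
    · exact hA a
    · obtain ⟨a, ha⟩ := h b
      exact (splitGraph_adj_inr_inl.2 ha).reachable.trans (hA a)
  have : Nonempty (A ⊕ B) := ⟨.inl a₀⟩
  exact ⟨fun x y => (hB x).trans (hB y).symm⟩

theorem edist_splitGraph_inr_inr_le_two {b b' : B} :
    (splitGraph N).edist (.inr b) (.inr b') ≤ (2 : ℕ) ↔ b = b' ∨ ∃ a, N a b ∧ N a b' := by
  rw [← not_iff_not, not_le, Nat.cast_ofNat, SimpleGraph.two_lt_edist_iff, not_or,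
    Set.eq_empty_iff_forall_notMem, not_exists, Sum.forall]
  simp [SimpleGraph.mem_commonNeighbors, splitGraph_adj_inr_inl, splitGraph_not_adj_inr_inr]

theorem isDistDominating_splitGraph_map_inr_iff [Nonempty A] (h : ∀ b, ∃ a, N a b)
    {D : Finset B} : IsDistDominating (splitGraph N) 2 (D.map .inr) ↔
      D.Nonempty ∧ ∀ b, ∃ b' ∈ D, b = b' ∨ ∃ a, N a b ∧ N a b' := by
  constructor
  · intro hD
    have hB : ∀ b, ∃ b' ∈ D, b = b' ∨ ∃ a, N a b ∧ N a b' := by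
      intro b
      obtain ⟨v, hv, hle⟩ := hD (.inr b)
      obtain ⟨b', hb', rfl⟩ := mem_map.1 hv
      exact ⟨b', hb', edist_splitGraph_inr_inr_le_two.1 hle⟩
    obtain ⟨a⟩ := ‹Nonempty A›
    obtain ⟨v, hv, -⟩ := hD (.inl a)
    exact ⟨map_nonempty.1 ⟨v, hv⟩, hB⟩
  · rintro ⟨⟨b₀, hb₀⟩, hB⟩ (a | b)
    · have hG := connected_splitGraph h
      refine ⟨.inr b₀, mem_map_of_mem _ hb₀, ?_⟩
      rw [← (hG _ _).coe_dist_eq_edist, SimpleGraph.dist_comm]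
      exact_mod_cast isSplitPartition_splitGraph.dist_le_two hG (Set.mem_range_self a) _
    · obtain ⟨b', hb', hor⟩ := hB b
      exact ⟨.inr b', mem_map_of_mem _ hb', edist_splitGraph_inr_inr_le_two.2 hor⟩

end SplitGraphOfRelation

/-! ### Sharpness for token jumping. -/

section TightTokenJumping

variable {k : ℕ}

/-- The clique vertex `(i, j)` is adjacent to the `i`-th vertex of the source, the `j`-th vertex
of the target, and one further vertex of its own. -/
def gridRel (k : ℕ) (a : Fin k × Fin k) : (Fin k ⊕ Fin k) ⊕ (Fin k × Fin k) → Prop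
  | .inl (.inl i) => i = a.1
  | .inl (.inr j) => j = a.2
  | .inr c => c = a

theorem exists_gridRel (b : (Fin k ⊕ Fin k) ⊕ (Fin k × Fin k)) : ∃ a, gridRel k a b := by
  rcases b with (i | j) | c
  · exact ⟨(i, i), rfl⟩
  · exact ⟨(j, j), rfl⟩
  · exact ⟨c, rfl⟩

/-- The source of the instance given by `gridRel`, without the embedding into the graph. -/
def gridSource (k : ℕ) : Finset ((Fin k ⊕ Fin k) ⊕ (Fin k × Fin k)) :=
  (univ.map .inl).map .inl

/-- The target of the instance given by `gridRel`, without the embedding into the graph. -/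
def gridTarget (k : ℕ) : Finset ((Fin k ⊕ Fin k) ⊕ (Fin k × Fin k)) :=
  (univ.map .inr).map .inl

theorem mem_gridSource {b} : b ∈ gridSource k ↔ ∃ i, b = .inl (.inl i) := by
  simp [gridSource, eq_comm]

theorem mem_gridTarget {b} : b ∈ gridTarget k ↔ ∃ j, b = .inl (.inr j) := by
  simp [gridTarget, eq_comm]

theorem disjoint_gridSource_gridTarget : Disjoint (gridSource k) (gridTarget k) := by
  rw [disjoint_left]
  intro b hb hb'
  obtain ⟨i, rfl⟩ := mem_gridSource.1 hb
  obtain ⟨j, hj⟩ := mem_gridTarget.1 hb'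
  simp at hj

theorem isSplitInstance_grid (hk : 0 < k) :
    IsSplitInstance (splitGraph (gridRel k)) (Set.range Sum.inl) (Set.range Sum.inr) 2
      ((gridSource k).map .inr) ((gridTarget k).map .inr) := by
  have i₀ : Fin k := ⟨0, hk⟩
  have : Nonempty (Fin k × Fin k) := ⟨(i₀, i₀)⟩
  refine ⟨connected_splitGraph exists_gridRel, isSplitPartition_splitGraph, ?_, ?_, ?_⟩
  · refine (isDistDominating_splitGraph_map_inr_iff exists_gridRel).2
      ⟨⟨_, mem_gridSource.2 ⟨i₀, rfl⟩⟩, ?_⟩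
    rintro ((i | j) | c)
    · exact ⟨_, mem_gridSource.2 ⟨i, rfl⟩, Or.inl rfl⟩
    · exact ⟨_, mem_gridSource.2 ⟨i₀, rfl⟩, Or.inr ⟨(i₀, j), rfl, rfl⟩⟩
    · exact ⟨_, mem_gridSource.2 ⟨c.1, rfl⟩, Or.inr ⟨c, rfl, rfl⟩⟩
  · refine (isDistDominating_splitGraph_map_inr_iff exists_gridRel).2
      ⟨⟨_, mem_gridTarget.2 ⟨i₀, rfl⟩⟩, ?_⟩
    rintro ((i | j) | c)
    · exact ⟨_, mem_gridTarget.2 ⟨i₀, rfl⟩, Or.inr ⟨(i, i₀), rfl, rfl⟩⟩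
    · exact ⟨_, mem_gridTarget.2 ⟨j, rfl⟩, Or.inl rfl⟩
    · exact ⟨_, mem_gridTarget.2 ⟨c.2, rfl⟩, Or.inr ⟨c, rfl, rfl⟩⟩
  · simp [gridSource, gridTarget]

/-- In a sequence of length `k` the first jump would go from a source vertex `i` to a target vertex
`j`. For `j' ≠ j` the private vertex of `(i, j')` then has no token within distance 2. -/
theorem opt_TJ_grid (hk : 2 ≤ k) :
    opt .TJ (splitGraph (gridRel k)) 2 ((gridSource k).map .inr) ((gridTarget k).map .inr) =
      (minTJ ((gridSource k).map .inr : Finset ((Fin k × Fin k) ⊕ _))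
        ((gridTarget k).map .inr) : ℕ∞) + 1 := by
  have hI := isSplitInstance_grid (k := k) (by omega)
  have i₀ : Fin k := ⟨0, by omega⟩
  have : Nonempty (Fin k × Fin k) := ⟨(i₀, i₀)⟩
  have : Nontrivial (Fin k) := Fin.nontrivial_iff_two_le.2 hk
  have hdisj : Disjoint ((gridSource k).map (.inr : _ ↪ (Fin k × Fin k) ⊕ _))
      ((gridTarget k).map .inr) := (disjoint_map _).2 disjoint_gridSource_gridTarget
  have hcard : #((gridSource k).map (.inr : _ ↪ (Fin k × Fin k) ⊕ _)) = k := by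
    simp [gridSource]
  refine le_antisymm hI.opt_le_minTJ_add_one (le_opt fun q s hs => ?_)
  rw [minTJ_eq_card_sdiff hI.card_eq, sdiff_eq_self_of_disjoint hdisj, hcard]
  suffices k < q by exact_mod_cast this
  by_contra hqk
  obtain ⟨x, hx, y, hy, -, e⟩ := (hs.step 0 (by
    have := hs.card_sdiff_le (Nat.zero_le q)
    rw [hs.first, sdiff_eq_self_of_disjoint hdisj, hcard] at this
    omega)).exists_eq_insert_erase
  have hq : 0 < q := by
    have := hs.card_sdiff_le (Nat.zero_le q)
    rw [hs.first, sdiff_eq_self_of_disjoint hdisj, hcard] at this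
    omega
  have h1 := hs.card_sdiff_le hq
  have d1 := hs.dominating 1 hq
  rw [zero_add] at e
  rw [hs.first] at e hx hy
  -- Otherwise all `k` tokens are still misplaced, with at most `k - 1` jumps left.
  have hyT : y ∈ (gridTarget k).map .inr := by
    by_contra hyT
    rw [e, insert_sdiff_of_notMem _ hyT, erase_sdiff_comm, sdiff_eq_self_of_disjoint hdisj,
      card_insert_of_notMem (fun h => hy (mem_of_mem_erase h)), card_erase_add_one hx,
      hcard] at h1
    omega
  obtain ⟨b, hb, rfl⟩ := mem_map.1 hx
  obtain ⟨i, rfl⟩ := mem_gridSource.1 hb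
  obtain ⟨c, hc, rfl⟩ := mem_map.1 hyT
  obtain ⟨j, rfl⟩ := mem_gridTarget.1 hc
  obtain ⟨j', hj'⟩ := exists_ne j
  have e' : s 1 = (insert (.inl (.inr j)) ((gridSource k).erase (.inl (.inl i)))).map .inr := by
    rw [e, map_insert, map_erase]
  rw [e', isDistDominating_splitGraph_map_inr_iff exists_gridRel] at d1
  obtain ⟨b', hb', hor⟩ := d1.2 (.inr (i, j'))
  rw [mem_insert, mem_erase] at hb'
  rcases hb' with rfl | ⟨hne, hb'⟩
  · rcases hor with h | ⟨a, rfl, h⟩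
    · simp at h
    · exact hj' h.symm
  · obtain ⟨i', rfl⟩ := mem_gridSource.1 hb'
    rcases hor with h | ⟨a, rfl, h⟩
    · simp at h
    · exact hne (by rw [show i' = i from h])

end TightTokenJumping

/-! ### Sharpness for token sliding. -/

section TightTokenSliding

/-- Each slide changes the parity of the number of tokens on one side of a bipartition. -/
theorem Step.card_filter_mod_two {V : Type*} [DecidableEq V] {G : SimpleGraph V}
    {D D' : Finset V} (h : Step .TS G D D') {P : V → Prop} [DecidablePred P]
    (hP : ∀ x y, G.Adj x y → (P x ↔ ¬ P y)) : (#{x ∈ D' | P x} + #{x ∈ D | P x}) % 2 = 1 := by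
  obtain ⟨x, hx, y, hy, hxy, rfl⟩ := h.exists_eq_insert_erase
  have hxy : G.Adj x y := hxy
  have h1 := hP x y hxy
  rw [filter_insert, filter_erase]
  by_cases hy' : P y
  · have hx' : x ∉ {x ∈ D | P x} := fun h => h1.1 (mem_filter.1 h).2 hy'
    rw [if_pos hy', erase_eq_of_notMem hx', card_insert_of_notMem (by simp [hy])]
    omega
  · have hx' : x ∈ {x ∈ D | P x} := mem_filter.2 ⟨hx, h1.2 hy'⟩
    have := card_erase_add_one hx'
    rw [if_neg hy']
    omega

theorem IsReconfSeq.card_filter_mod_two {V : Type*} [DecidableEq V] {G : SimpleGraph V}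
    {r q : ℕ} {D D' : Finset V} {s : ℕ → Finset V} (h : IsReconfSeq .TS G r D D' q s)
    {P : V → Prop} [DecidablePred P] (hP : ∀ x y, G.Adj x y → (P x ↔ ¬ P y)) :
    (#{x ∈ D' | P x} + #{x ∈ D | P x}) % 2 = q % 2 := by
  have key : ∀ i ≤ q, (#{x ∈ s i | P x} + #{x ∈ D | P x}) % 2 = i % 2 := by
    intro i
    induction i with
    | zero =>
      intro _
      rw [h.first]
      omega
    | succ i ih =>
      intro hi
      have h1 := ih (by omega)
      have h2 := (h.step i hi).card_filter_mod_two hP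
      omega
  rw [← key q le_rfl, h.last]

variable {n : ℕ}

/-- The clique vertex `0` has the leaves `some i`, the clique vertex `1` has the leaf `none`. -/
def doubleStarRel (n : ℕ) (a : Fin 2) (b : Option (Fin n)) : Prop :=
  a = 0 ↔ b.isSome

theorem exists_doubleStarRel (b : Option (Fin n)) : ∃ a, doubleStarRel n a b := by
  cases b
  · exact ⟨1, by simp [doubleStarRel]⟩
  · exact ⟨0, by simp [doubleStarRel]⟩

/-- The token set occupying the centre `0` and all leaves attached to it but the `i`-th one. -/
def starTokens (i : Fin n) : Finset (Fin 2 ⊕ Option (Fin n)) :=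
  insert (.inl 0) ((univ.erase i).image fun j => .inr (some j))

theorem inl_mem_starTokens {i : Fin n} {a : Fin 2} : .inl a ∈ starTokens i ↔ a = 0 := by
  simp [starTokens]

theorem inr_mem_starTokens {i : Fin n} {b : Option (Fin n)} :
    .inr b ∈ starTokens i ↔ ∃ j ≠ i, b = some j := by
  simp [starTokens, eq_comm]

theorem card_starTokens (i : Fin n) : #(starTokens i) = n := by
  have hn : 0 < n := i.pos
  rw [starTokens, card_insert_of_notMem (by simp), card_image_of_injective _ (fun a b h => by
    simpa using h), card_erase_of_mem (mem_univ _), card_univ, Fintype.card_fin]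
  omega

theorem isSplitInstance_starTokens (i j : Fin n) :
    IsSplitInstance (splitGraph (doubleStarRel n)) (Set.range Sum.inl) (Set.range Sum.inr) 2
      (starTokens i) (starTokens j) := by
  have hG := connected_splitGraph (exists_doubleStarRel (n := n))
  exact ⟨hG, isSplitPartition_splitGraph,
    isSplitPartition_splitGraph.isDistDominating_of_mem hG (inl_mem_starTokens.2 rfl)
      (Set.mem_range_self _),
    isSplitPartition_splitGraph.isDistDominating_of_mem hG (inl_mem_starTokens.2 rfl)
      (Set.mem_range_self _), by rw [card_starTokens, card_starTokens]⟩

theorem minTS_starTokens_le {i j : Fin n} (hij : i ≠ j) :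
    minTS (splitGraph (doubleStarRel n)) (starTokens i) (starTokens j) ≤ 2 := by
  have hG := connected_splitGraph (exists_doubleStarRel (n := n))
  set x : Fin 2 ⊕ Option (Fin n) := .inr (some j)
  set y : Fin 2 ⊕ Option (Fin n) := .inr (some i)
  have hx : x ∈ starTokens i := inr_mem_starTokens.2 ⟨j, hij.symm, rfl⟩
  have hy : y ∉ starTokens i := by simp [y, inr_mem_starTokens]
  have himg : (starTokens i).image (swap x y) = starTokens j := by
    rw [image_swap_eq_insert_erase hx hy]
    ext (a | (_ | b))
    · simp [x, y, inl_mem_starTokens]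
    · simp [x, y, inr_mem_starTokens]
    · simp only [x, y, mem_insert, mem_erase, inr_mem_starTokens]
      simp
      grind
  -- Here `σ * swap x y` is the identity, so the cost of the matching is just the distance between
  -- the two leaves.
  have hcost := cost_mul_swap_insert_erase_add (G := splitGraph (doubleStarRel n))
    (σ := swap x y) hx hy
  have hdist : (splitGraph (doubleStarRel n)).dist x y ≤ 2 := by
    have := (edist_splitGraph_inr_inr_le_two (N := doubleStarRel n) (b := some j)
      (b' := some i)).2 (Or.inr ⟨0, by simp [doubleStarRel], by simp [doubleStarRel]⟩)
    rw [← (hG _ _).coe_dist_eq_edist] at this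
    exact_mod_cast this
  refine (minTS_le_cost hG himg).trans ?_
  rw [swap_mul_self, swap_apply_left, SimpleGraph.dist_self] at hcost
  have h0 : cost (splitGraph (doubleStarRel n)) 1 (insert y ((starTokens i).erase x)) = 0 := by
    simp [cost]
  exact_mod_cast (by omega)

/-- The double star is bipartite, with classes `{0, none}` and the rest. Both token sets have one
token in the first class, so the length is even; it remains to exclude 0 and 2. -/
theorem four_le_opt_TS_starTokens {i j : Fin n} (hij : i ≠ j) :
    4 ≤ opt .TS (splitGraph (doubleStarRel n)) 2 (starTokens i) (starTokens j) := by
  refine le_opt fun q s hs => ?_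
  suffices 4 ≤ q by exact_mod_cast this
  have hP : ∀ x y, (splitGraph (doubleStarRel n)).Adj x y →
      ((x = .inl 0 ∨ x = .inr none) ↔ ¬ (y = .inl 0 ∨ y = .inr none)) := by
    rintro (a | (_ | b)) (a' | (_ | b')) h
    · have h := splitGraph_adj_inl_inl.1 h
      simp
      omega
    all_goals first
      | exact absurd h splitGraph_not_adj_inr_inr
      | (first
          | rw [splitGraph_adj_inl_inr] at h
          | rw [splitGraph_adj_inr_inl] at h
         simp [doubleStarRel] at h ⊢
         assumption)
  have hfilter : ∀ i : Fin n, {x ∈ starTokens i | x = .inl 0 ∨ x = .inr none} = {.inl 0} := by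
    intro i
    ext (a | b)
    · simp [inl_mem_starTokens]
    · cases b <;> simp [inr_mem_starTokens]
  have hpar := hs.card_filter_mod_two hP
  rw [hfilter, hfilter, card_singleton] at hpar
  have hq0 : q ≠ 0 := by
    rintro rfl
    have h : starTokens i = starTokens j := hs.first.symm.trans hs.last
    have hj : (.inr (some j) : Fin 2 ⊕ Option (Fin n)) ∈ starTokens i :=
      inr_mem_starTokens.2 ⟨j, hij.symm, rfl⟩
    rw [h] at hj
    simp [inr_mem_starTokens] at hj
  by_contra hlt
  obtain rfl : q = 2 := by omega
  obtain ⟨x, hx, y, hy, hxy, e⟩ := (hs.step 0 (by omega)).exists_eq_insert_erase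
  have h1 := hs.card_sdiff_le (show 1 ≤ 2 by omega)
  have d1 := hs.dominating 1 (by omega)
  have hxy : (splitGraph (doubleStarRel n)).Adj x y := hxy
  rw [zero_add] at e
  rw [hs.first] at e hx hy
  -- An occupied leaf can only slide to the centre `0`, which is occupied, so the centre token moves
  -- first.
  have hx0 : x = .inl 0 := by
    rcases x with a | b
    · rw [inl_mem_starTokens.1 hx]
    · obtain ⟨j', -, rfl⟩ := inr_mem_starTokens.1 hx
      rcases y with a | b
      · have h := splitGraph_adj_inr_inl.1 hxy
        exact absurd (inl_mem_starTokens.2 (by simpa [doubleStarRel] using h)) hy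
      · exact absurd hxy splitGraph_not_adj_inr_inr
  subst hx0
  rcases y with a | b
  · have ha : a ≠ 0 := fun ha => hy (inl_mem_starTokens.2 ha)
    -- If it moves to the other clique vertex, two tokens are misplaced with one slide left.
    have hsub : {.inl a, .inr (some j)} ⊆ s 1 \ starTokens j := by
      rw [e]
      intro z hz
      rw [mem_insert, mem_singleton] at hz
      rcases hz with rfl | rfl
      · simp [inl_mem_starTokens, ha]
      · simp [inr_mem_starTokens, hij.symm]
    have := card_le_card hsub
    rw [card_pair (by simp)] at this
    omega
  -- If it moves to a leaf, all tokens are on leaves of `0`, and the leaf `none` is not dominated.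
  · obtain ⟨v, hv, hle⟩ := d1 (.inr none)
    rw [e, mem_insert, mem_erase] at hv
    have hb : b ≠ none := by
      rintro rfl
      have := splitGraph_adj_inl_inr.1 hxy
      simp [doubleStarRel] at this
    obtain ⟨c, rfl⟩ : ∃ c, v = .inr (some c) := by
      rcases hv with rfl | ⟨hne, hv⟩
      · obtain ⟨c, rfl⟩ := Option.ne_none_iff_exists'.1 hb
        exact ⟨c, rfl⟩
      · rcases v with a | b'
        · exact absurd (by rw [inl_mem_starTokens.1 hv]) hne
        · obtain ⟨c, -, rfl⟩ := inr_mem_starTokens.1 hv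
          exact ⟨c, rfl⟩
    rcases edist_splitGraph_inr_inr_le_two.1 hle with h | ⟨a, ha, ha'⟩
    · simp at h
    · simp only [doubleStarRel, Option.isSome_none, Option.isSome_some] at ha ha'
      simp_all

end TightTokenSliding

end DomReconf

theorem mainTheorem2 :
    (∀ {V : Type*} [Fintype V] [DecidableEq V] (G : SimpleGraph V) (K S : Set V)
        (Ds Dt : Finset V), DomReconf.IsSplitInstance G K S 2 Ds Dt →
      (DomReconf.minTS G Ds Dt ≤ DomReconf.opt .TS G 2 Ds Dt ∧
        DomReconf.opt .TS G 2 Ds Dt ≤ DomReconf.minTS G Ds Dt + 2) ∧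
      ((DomReconf.minTJ Ds Dt : ℕ∞) ≤ DomReconf.opt .TJ G 2 Ds Dt ∧
        DomReconf.opt .TJ G 2 Ds Dt ≤ (DomReconf.minTJ Ds Dt : ℕ∞) + 1)) ∧
    (∀ k : ℕ, 2 ≤ k →
      ∃ (V : Type) (_ : Fintype V) (_ : DecidableEq V) (G : SimpleGraph V) (K S : Set V)
        (Ds Dt : Finset V), DomReconf.IsSplitInstance G K S 2 Ds Dt ∧ Ds.card = k ∧
        DomReconf.opt .TS G 2 Ds Dt = DomReconf.minTS G Ds Dt + 2) ∧
    (∀ k : ℕ, 2 ≤ k →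
      ∃ (V : Type) (_ : Fintype V) (_ : DecidableEq V) (G : SimpleGraph V) (K S : Set V)
        (Ds Dt : Finset V), DomReconf.IsSplitInstance G K S 2 Ds Dt ∧ Ds.card = k ∧
        DomReconf.opt .TJ G 2 Ds Dt = (DomReconf.minTJ Ds Dt : ℕ∞) + 1) := by
  refine ⟨fun G K S Ds Dt h => ⟨⟨h.minTS_le_opt, h.opt_le_minTS_add_two⟩,
    ⟨h.minTJ_le_opt, h.opt_le_minTJ_add_one⟩⟩, fun k hk => ?_, fun k hk => ?_⟩
  · have h := DomReconf.isSplitInstance_starTokens (⟨0, by omega⟩ : Fin k) ⟨1, by omega⟩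
    have hne : (⟨0, by omega⟩ : Fin k) ≠ ⟨1, by omega⟩ := by simp
    refine ⟨_, inferInstance, inferInstance, _, _, _, _, _, h, DomReconf.card_starTokens _,
      le_antisymm h.opt_le_minTS_add_two ?_⟩
    exact (add_le_add (DomReconf.minTS_starTokens_le hne) le_rfl).trans
      ((by norm_num : (2 : ℕ∞) + 2 = 4).le.trans (DomReconf.four_le_opt_TS_starTokens hne))
  · exact ⟨_, inferInstance, inferInstance, _, _, _, _, _,
      DomReconf.isSplitInstance_grid (k := k) (by omega), by simp [DomReconf.gridSource],
      DomReconf.opt_TJ_grid hk⟩
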